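/- A Schröder tree is a finite plane (i.e. ordered), unlabelled rooted tree in which every non-leaf vertex has at least two children. For a Schröder tree $t$, let $|t|$ be its number of leaves and $\#t$ its total number of vertices (leaves included). Let $v_0,v_1,\dots,v_{2\#t-2}$ be the depth-first search walk on $t$: $v_0$ is the root, and $v_{i+1}$ is the leftmost child of $v_i$ not yet visited if there is one, and the parent of $v_i$ otherwise. The contour $C_t:[0,2\#t-2]\to[0,\infty)$ is the function whose value at each integer $i$ is the distance from the root to $v_i$, and which is linear between consecutive integers. The normalized contour is $\widetilde{C_t}(u)=|t|^{-1/2}\,C_t\big((2\#t-2)u\big)$, $u\in[0,1]$. If $|t|>1$, then $\widetilde{C_t}$ has exactly $|t|$ local maxima, which correspond to the leaves of $t$; let $\ell_1<\dots<\ell_{|t|}$ be their $x$-coordinates. The leaf distribution function of $t$ is $$F_t(x)=\frac1{|t|}\sum_{i=1}^{|t|}\mathbf 1_{[\ell_i\le x]},\qquad x\in\mathbb R.$$ Let $F_U$ be the distribution function of the uniform distribution on $[0,1]$, i.e. $F_U(x)=0$ for $x<0$, $F_U(x)=x$ for $0\le x\le1$, and $F_U(x)=1$ for $x>1$. **Proposition.**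 Let $(T_n)_{n\ge2}$ be random variables defined on a common probability space, with an arbitrary joint distribution, such that for every $n\ge 2$ the random tree $T_n$ is uniformly distributed on the finite set of Schröder trees with $n$ leaves. Then almost surely $$\|F_{T_n}-F_U\|_\infty=\sup_{x\in\mathbb R}|F_{T_n}(x)-F_U(x)|\longrightarrow0\qquad(n\to\infty).$$ -/

import Mathlib

open MeasureTheory ProbabilityTheory Filter Topology

/-- A (finite, plane, unlabelled) Schröder tree: either a leaf, or a root together with an
ordered tuple of at least two subtrees, which are themselves Schröder trees. -/
inductive SchroderTree : Type
  | leaf : SchroderTree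
  | node {k : ℕ} (children : Fin (k + 2) → SchroderTree) : SchroderTree

namespace SchroderTree

/-- Random trees are discrete random variables. -/
instance : MeasurableSpace SchroderTree := ⊤

/-- The size `|t|` of a tree: its number of leaves. -/
def numLeaves : SchroderTree → ℕ
  | leaf => 1
  | node c => ∑ i, numLeaves (c i)

/-- The number `#t` of all vertices of a tree, leaves and internal vertices together. -/
def numVertices : SchroderTree → ℕ
  | leaf => 1
  | node c => 1 + ∑ i, numVertices (c i)

/-- The depth-first search walk of `t`: the list of the `2 #t - 1` successively visited vertices.
A vertex is written as its path from the root: `[]` is the root, and `i :: p` is the vertex `p`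
of the `i`-th subtree of the root (counted from the left, starting at 0). The walk starts at the
root; it enters the subtrees from left to right, and returns to the root after each of them. -/
def dfs : SchroderTree → List (List ℕ)
  | leaf => [[]]
  | node c => [] :: (List.finRange _).flatMap
      (fun i => (dfs (c i)).map (fun p => (i : ℕ) :: p) ++ [[]])

/-- The distance from the root of `t` to the vertex visited at time `i`, `0 ≤ i ≤ 2 #t - 2`
(`0` at later times, which are not used). -/
def height (t : SchroderTree) (i : ℕ) : ℕ := (t.dfs.getD i []).length

/-- The contour `C_t` on `[0, 2 #t - 2]`: the linear interpolation of the heights at integers. -/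
noncomputable def contour (t : SchroderTree) (x : ℝ) : ℝ :=
  (t.height ⌊x⌋₊ : ℝ) + (x - (⌊x⌋₊ : ℝ)) * ((t.height (⌊x⌋₊ + 1) : ℝ) - (t.height ⌊x⌋₊ : ℝ))

/-- The normalized contour on `[0, 1]`. -/
noncomputable def normalizedContour (t : SchroderTree) (u : ℝ) : ℝ :=
  (1 / Real.sqrt (t.numLeaves : ℝ)) * t.contour ((2 * (t.numVertices : ℝ) - 2) * u)

/-- The `x`-coordinates of the leaves of `t` (where `|t| > 1`): the points of `[0, 1]` at which
the normalized contour, as a function on `[0, 1]`, has a local maximum. -/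
def leafCoordinates (t : SchroderTree) : Set ℝ :=
  {u | u ∈ Set.Icc (0 : ℝ) 1 ∧ IsLocalMaxOn t.normalizedContour (Set.Icc (0 : ℝ) 1) u}

/-- The leaf distribution function `F_t` of a tree `t` with `|t| > 1`: the number of leaf
coordinates that are at most `x`, divided by `|t|`. -/
noncomputable def leafDistribution (t : SchroderTree) (x : ℝ) : ℝ :=
  (1 / (t.numLeaves : ℝ)) * (({l ∈ t.leafCoordinates | l ≤ x}.ncard : ℕ) : ℝ)

end SchroderTree

/-- The distribution function of the uniform distribution on `[0, 1]`. -/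
noncomputable def uniformDistribution (x : ℝ) : ℝ :=
  if x < 0 then 0 else if x ≤ 1 then x else 1

/-! Write a tree in preorder, with `0` for a leaf and the number of children minus one for an
internal vertex. A tree with n leaves and m internal vertices becomes a word with n zeros, m
positive letters and sum n - 1. By the cycle lemma every such word is a rotation of a tree word
(`exists_rotate_word_eq`), so tree words make up at least a fraction 1/(n+m+1) of them. Among all
these words the positions of the zeros are independent of the composition of n - 1 formed by the
positive letters, and are uniform. A Chernoff bound for Bernoulli variables conditioned on their sum
then shows that some prefix has a wrong share of zeros with probability at most a polynomial times
exp(-ε²n/8). The polynomial losses (conditioning, union bound, rotation) are harmless: the bounds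
are summable, and Borel–Cantelli requires nothing of the joint law.

This controls leaves against preorder rank, whereas F_t uses contour time; the discrepancy is the
height. No height bound is needed. If N is the number of vertices and b of the first k steps go up,
the proportion of leaves seen is close to b/N. The mirror image of the tree, which is again uniform,
gives (k-b)/N for the same proportion. Averaging eliminates b and leaves k/(2N), which is close to x
(`abs_numPeaks_div_sub_le`). -/

/-! ### Lists over a finite set and the mode of the binomial law -/

/-- The lists of length `n` with entries in `s`. -/
def listsOver {α : Type*} [DecidableEq α] (s : Finset α) : ℕ → Finset (List α)
  | 0 => {[]}
  | n + 1 => (s ×ˢ listsOver s n).image (fun p => p.1 :: p.2)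

theorem mem_listsOver {α : Type*} [DecidableEq α] {s : Finset α} {n : ℕ} {l : List α} :
    l ∈ listsOver s n ↔ l.length = n ∧ ∀ a ∈ l, a ∈ s := by
  induction n generalizing l with
  | zero => cases l <;> simp [listsOver]
  | succ n ih =>
    cases l with
    | nil => simp [listsOver]
    | cons a l => simp [listsOver, ih]; tauto

theorem sum_listsOver_succ {α β : Type*} [DecidableEq α] [AddCommMonoid β] (s : Finset α) (n : ℕ)
    (f : List α → β) :
    ∑ l ∈ listsOver s (n + 1), f l = ∑ a ∈ s, ∑ l ∈ listsOver s n, f (a :: l) := by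
  rw [listsOver, Finset.sum_image, Finset.sum_product]
  rintro ⟨a, l⟩ _ ⟨b, m⟩ _ h
  simpa using h

theorem card_filter_count_listsOver (N k : ℕ) :
    ((listsOver (Finset.univ : Finset Bool) N).filter (fun b => b.count true = k)).card
      = N.choose k := by
  induction N generalizing k with
  | zero => cases k <;> simp [listsOver, Finset.filter_singleton]
  | succ N ih =>
    rw [Finset.card_filter, sum_listsOver_succ]
    simp only [Fintype.sum_bool, List.count_cons]
    cases k with
    | zero => simpa using ih 0
    | succ k =>
      rw [Nat.choose_succ_succ, ← ih, ← ih, Finset.card_filter, Finset.card_filter]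
      simp

/-- The largest term in the binomial expansion of `(n + m) ^ (n + m)`. -/
theorem choose_mul_pow_le (n m k : ℕ) (hk : k ≤ n + m) :
    (n + m).choose k * (n ^ k * m ^ (n + m - k)) ≤ (n + m).choose n * (n ^ n * m ^ m) := by
  -- By this identity, consecutive terms compare as (n+m-k)n against (k+1)m. The former is larger
  -- for k < n and smaller for k ≥ n, so both inductions move towards n.
  have key : ∀ k, (n + m).choose (k + 1) * (k + 1) = (n + m).choose k * (n + m - k) :=
    fun k => Nat.choose_succ_right_eq _ _
  rcases le_total k n with h | h
  · induction h using Nat.decreasingInduction with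
    | self => simp
    | of_succ k hkn ih =>
      refine le_trans ?_ (ih (by omega))
      have h1 : n + m - k = n + m - (k + 1) + 1 := by omega
      rw [h1, pow_succ, pow_succ]
      have h2 : (n + m).choose k * m ≤ (n + m).choose (k + 1) * n := by
        refine Nat.le_of_mul_le_mul_right ?_ (show 0 < k + 1 by omega)
        calc (n + m).choose k * m * (k + 1) = (n + m).choose k * (m * (k + 1)) := by ring
          _ ≤ (n + m).choose k * ((n + m - k) * n) := by gcongr <;> omega
          _ = (n + m).choose (k + 1) * (k + 1) * n := by rw [key]; ring
          _ = _ := by ring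
      calc _ = ((n + m).choose k * m) * (n ^ k * m ^ (n + m - (k + 1))) := by ring
        _ ≤ ((n + m).choose (k + 1) * n) * (n ^ k * m ^ (n + m - (k + 1))) := by gcongr
        _ = _ := by ring
  · induction k, h using Nat.le_induction with
    | base => simp
    | succ k hkn ih =>
      refine le_trans ?_ (ih (by omega))
      have h1 : n + m - k = n + m - (k + 1) + 1 := by omega
      rw [h1, pow_succ, pow_succ]
      have h2 : (n + m).choose (k + 1) * n ≤ (n + m).choose k * m := by
        refine Nat.le_of_mul_le_mul_right ?_ (show 0 < k + 1 by omega)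
        calc (n + m).choose (k + 1) * n * (k + 1) = (n + m).choose (k + 1) * (k + 1) * n := by ring
          _ = (n + m).choose k * ((n + m - k) * n) := by rw [key]; ring
          _ ≤ (n + m).choose k * (m * (k + 1)) := by gcongr <;> omega
          _ = _ := by ring
      calc _ = ((n + m).choose (k + 1) * n) * (n ^ k * m ^ (n + m - (k + 1))) := by ring
        _ ≤ ((n + m).choose k * m) * (n ^ k * m ^ (n + m - (k + 1))) := by gcongr
        _ = _ := by ring

theorem add_pow_add_le (n m : ℕ) :
    (n + m) ^ (n + m) ≤ (n + m + 1) * ((n + m).choose n * (n ^ n * m ^ m)) := by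
  rw [add_pow]
  refine (Finset.sum_le_card_nsmul _ _ ((n + m).choose n * (n ^ n * m ^ m)) ?_).trans (by simp)
  intro k hk
  have := choose_mul_pow_le n m k (by simpa [Nat.lt_succ_iff] using hk)
  simpa [mul_comm, mul_assoc, mul_left_comm] using this

/-- A binomial variable with n+m trials and success probability n/(n+m) has n+m+1 values, of which n
is the likeliest. This is the price of conditioning on the number of successes. -/
theorem one_le_choose_mul_pow (n m : ℕ) (h : 0 < n + m) :
    (1 : ℝ) ≤ (n + m + 1) * ((n + m).choose n *
      ((n / (n + m : ℝ)) ^ n * (1 - n / (n + m : ℝ)) ^ m)) := by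
  have hN : (0 : ℝ) < n + m := by exact_mod_cast h
  have h1 : (1 : ℝ) - n / (n + m : ℝ) = m / (n + m : ℝ) := by field_simp; ring
  have h2 : ((n + m : ℝ)) ^ (n + m) ≤ (n + m + 1) * ((n + m).choose n * (n ^ n * m ^ m)) := by
    exact_mod_cast add_pow_add_le n m
  rw [h1, div_pow, div_pow, div_mul_div_comm, ← pow_add, mul_div_assoc', mul_div_assoc',
    one_le_div (by positivity)]
  exact h2

/-! ### Chernoff bound for prefixes of a conditioned Bernoulli sequence -/

/-- The probability of a list of independent Bernoulli variables. -/
noncomputable def bernoulliWeight (p : ℝ) (b : List Bool) : ℝ :=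
  (b.map (fun x => if x then p else 1 - p)).prod

theorem bernoulliWeight_eq (p : ℝ) (b : List Bool) :
    bernoulliWeight p b = p ^ b.count true * (1 - p) ^ (b.length - b.count true) := by
  induction b with
  | nil => simp [bernoulliWeight]
  | cons a b ih =>
    have : b.count true ≤ b.length := List.count_le_length
    unfold bernoulliWeight at ih ⊢
    cases a
    · simp [ih, Nat.succ_sub this, pow_succ]; ring
    · simp [ih, pow_succ]; ring

theorem bernoulliWeight_nonneg {p : ℝ} (h0 : 0 ≤ p) (h1 : p ≤ 1) (b : List Bool) :
    0 ≤ bernoulliWeight p b := by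
  have : 0 ≤ 1 - p := by linarith
  rw [bernoulliWeight_eq]; positivity

/-- Since e^y ≤ 1 + y + y² for |y| ≤ 1, and the linear terms cancel because the variable is centred.
-/
theorem bernoulli_mgf_le {p θ : ℝ} (h0 : 0 ≤ p) (h1 : p ≤ 1) (hθ : |θ| ≤ 1) :
    p * Real.exp (θ * (1 - p)) + (1 - p) * Real.exp (θ * (0 - p)) ≤ Real.exp (θ ^ 2) := by
  have bound : ∀ x : ℝ, |x| ≤ 1 → Real.exp (θ * x) ≤ 1 + θ * x + θ ^ 2 := by
    intro x hx
    have hx' : |θ * x| ≤ 1 := by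
      rw [abs_mul]; exact mul_le_one₀ hθ (abs_nonneg _) hx
    have h2 := (abs_le.1 (Real.abs_exp_sub_one_sub_id_le hx')).2
    have h3 : x ^ 2 ≤ 1 := (sq_le_one_iff_abs_le_one x).2 hx
    nlinarith [sq_nonneg θ]
  have e1 := bound (1 - p) (abs_le.2 ⟨by linarith, by linarith⟩)
  have e2 := bound (0 - p) (abs_le.2 ⟨by linarith, by linarith⟩)
  have h1' : 0 ≤ 1 - p := by linarith
  calc _ ≤ p * (1 + θ * (1 - p) + θ ^ 2) + (1 - p) * (1 + θ * (0 - p) + θ ^ 2) := by gcongr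
    _ = θ ^ 2 + 1 := by ring
    _ ≤ _ := Real.add_one_le_exp _

/-- Independence takes the form of an induction on the first entry, which splits off one centred
factor. The entries beyond the prefix contribute only their total mass. -/
theorem sum_bernoulliWeight_mul_exp_le {p θ : ℝ} (h0 : 0 ≤ p) (h1 : p ≤ 1) (hθ : |θ| ≤ 1)
    (N j : ℕ) (hj : j ≤ N) :
    ∑ b ∈ listsOver (Finset.univ : Finset Bool) N, bernoulliWeight p b *
      Real.exp (θ * (((b.take j).count true : ℕ) - p * j)) ≤ Real.exp (j * θ ^ 2) := by
  induction N generalizing j with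
  | zero =>
    obtain rfl : j = 0 := by omega
    simp [listsOver, bernoulliWeight]
  | succ N ih =>
    rw [sum_listsOver_succ, Fintype.sum_bool, ]
    cases j with
    | zero =>
      have := ih 0 (by omega)
      simp [bernoulliWeight, ← Finset.mul_sum] at this ⊢
      linarith
    | succ j =>
      have ihj := ih j (by omega)
      have e1 : ∀ b : List Bool, bernoulliWeight p (true :: b) *
          Real.exp (θ * ((((true :: b).take (j + 1)).count true : ℕ) - p * (j + 1 : ℕ))) =
          (p * Real.exp (θ * (1 - p))) * (bernoulliWeight p b *
            Real.exp (θ * (((b.take j).count true : ℕ) - p * j))) := by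
        intro b
        rw [show (p * Real.exp (θ * (1 - p))) * (bernoulliWeight p b *
            Real.exp (θ * (((b.take j).count true : ℕ) - p * j))) =
            (p * bernoulliWeight p b) * (Real.exp (θ * (1 - p)) *
            Real.exp (θ * (((b.take j).count true : ℕ) - p * j))) by ring, ← Real.exp_add]
        congr 1
        congr 1; simp; ring
      have e2 : ∀ b : List Bool, bernoulliWeight p (false :: b) *
          Real.exp (θ * ((((false :: b).take (j + 1)).count true : ℕ) - p * (j + 1 : ℕ))) =
          ((1 - p) * Real.exp (θ * (0 - p))) * (bernoulliWeight p b *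
            Real.exp (θ * (((b.take j).count true : ℕ) - p * j))) := by
        intro b
        rw [show ((1 - p) * Real.exp (θ * (0 - p))) * (bernoulliWeight p b *
            Real.exp (θ * (((b.take j).count true : ℕ) - p * j))) =
            ((1 - p) * bernoulliWeight p b) * (Real.exp (θ * (0 - p)) *
            Real.exp (θ * (((b.take j).count true : ℕ) - p * j))) by ring, ← Real.exp_add]
        congr 1
        congr 1; simp; ring
      simp only [e1, e2, ← Finset.mul_sum, ← add_mul]
      calc _ ≤ Real.exp (θ ^ 2) * Real.exp (j * θ ^ 2) := by
            refine mul_le_mul (bernoulli_mgf_le h0 h1 hθ) ihj ?_ (Real.exp_nonneg _)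
            exact Finset.sum_nonneg fun b _ =>
              mul_nonneg (bernoulliWeight_nonneg h0 h1 b) (Real.exp_nonneg _)
        _ = _ := by rw [← Real.exp_add]; congr 1; push_cast; ring

/-- All prefixes of `b` contain nearly the same proportion of `true` as `b` itself. -/
def Equidistributed (ε : ℝ) (b : List Bool) : Prop :=
  ∀ j ≤ b.length, |((b.take j).count true : ℝ) - b.count true / b.length * j|
    ≤ ε * b.count true

/-- The Bernoulli weight is constant on lists with exactly n entries `true`, so the cardinality
times this constant is a probability, to which the two-sided exponential Markov inequality applies.
-/
theorem card_filter_deviation_le {ε : ℝ} (h0 : 0 < ε) (h1 : ε ≤ 1) {n m : ℕ} (hm : m ≤ n)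
    (hn : 0 < n) (j : ℕ) (hj : j ≤ n + m) :
    (((listsOver (Finset.univ : Finset Bool) (n + m)).filter (fun b => b.count true = n ∧
      ε * n < |((b.take j).count true : ℝ) - n / (n + m) * j|)).card : ℝ) *
      ((n / (n + m : ℝ)) ^ n * (1 - n / (n + m : ℝ)) ^ m) ≤ 2 * Real.exp (-(ε ^ 2 / 8) * n) := by
  have hn' : (0 : ℝ) < n := by exact_mod_cast hn
  have hm' : (m : ℝ) ≤ n := by exact_mod_cast hm
  set p : ℝ := n / (n + m : ℝ) with hp
  have hp0 : 0 ≤ p := by positivity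
  have hp1 : p ≤ 1 := by rw [hp, div_le_one (by positivity)]; simp
  -- This minimises -θεn + 2nθ², which bounds the exponent because j ≤ n + m ≤ 2n; the minimum is
  -- -ε²n/8.
  set θ : ℝ := ε / 4 with hθ
  have hθ1 : |θ| ≤ 1 := by rw [abs_le]; constructor <;> linarith
  have hθ2 : |-θ| ≤ 1 := by rwa [abs_neg]
  have c1 := sum_bernoulliWeight_mul_exp_le hp0 hp1 hθ1 (n + m) j hj
  have c2 := sum_bernoulliWeight_mul_exp_le hp0 hp1 hθ2 (n + m) j hj
  have hE : Real.exp (-(θ * (ε * n))) * Real.exp (j * θ ^ 2) ≤ Real.exp (-(ε ^ 2 / 8) * n) := by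
    rw [← Real.exp_add, Real.exp_le_exp]
    have : (j : ℝ) ≤ 2 * n := by
      have : (j : ℝ) ≤ n + m := by exact_mod_cast hj
      linarith
    have := mul_le_mul_of_nonneg_right this (sq_nonneg θ)
    rw [hθ] at this ⊢
    nlinarith
  calc _ = ∑ b ∈ (listsOver (Finset.univ : Finset Bool) (n + m)).filter (fun b =>
          b.count true = n ∧ ε * n < |((b.take j).count true : ℝ) - p * j|),
          bernoulliWeight p b := by
        rw [← nsmul_eq_mul, ← Finset.sum_const]
        refine Finset.sum_congr rfl fun b hb => ?_
        simp only [Finset.mem_filter, mem_listsOver] at hb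
        rw [bernoulliWeight_eq, hb.1.1, hb.2.1, Nat.add_sub_cancel_left]
    _ ≤ ∑ b ∈ listsOver (Finset.univ : Finset Bool) (n + m),
          Real.exp (-(θ * (ε * n))) * (bernoulliWeight p b *
            Real.exp (θ * (((b.take j).count true : ℕ) - p * j)) + bernoulliWeight p b *
            Real.exp (-θ * (((b.take j).count true : ℕ) - p * j))) := by
        rw [Finset.sum_filter]
        refine Finset.sum_le_sum fun b _ => ?_
        have hw := bernoulliWeight_nonneg hp0 hp1 b
        split_ifs with hb
        · have : 1 ≤ Real.exp (-(θ * (ε * n))) *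
              (Real.exp (θ * (((b.take j).count true : ℕ) - p * j)) +
              Real.exp (-θ * (((b.take j).count true : ℕ) - p * j))) := by
            rw [mul_add, ← Real.exp_add, ← Real.exp_add]
            have hθ0 : 0 < θ := by positivity
            rcases lt_abs.1 hb.2 with h | h
            · have := Real.one_le_exp (x := -(θ * (ε * n)) +
                θ * (((b.take j).count true : ℕ) - p * j)) (by nlinarith)
              linarith [Real.exp_pos (-(θ * (ε * n)) +
                -θ * (((b.take j).count true : ℕ) - p * j))]
            · have := Real.one_le_exp (x := -(θ * (ε * n)) +
                -θ * (((b.take j).count true : ℕ) - p * j)) (by nlinarith)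
              linarith [Real.exp_pos (-(θ * (ε * n)) +
                θ * (((b.take j).count true : ℕ) - p * j))]
          nlinarith
        · positivity
    _ ≤ Real.exp (-(θ * (ε * n))) * (Real.exp (j * θ ^ 2) + Real.exp (j * (-θ) ^ 2)) := by
        rw [← Finset.mul_sum, Finset.sum_add_distrib]
        gcongr
    _ ≤ _ := by rw [neg_sq]; linarith

/-- One factor n+m+1 is the union bound over prefixes, the other pays for conditioning; the common
weight cancels. -/
theorem card_not_equidistributed_le {ε : ℝ} (h0 : 0 < ε) (h1 : ε ≤ 1) {n m : ℕ} (hm : m ≤ n)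
    (hn : 0 < n) [DecidablePred (Equidistributed ε)] :
    (((listsOver (Finset.univ : Finset Bool) (n + m)).filter (fun b => b.count true = n ∧
      ¬ Equidistributed ε b)).card : ℝ) ≤
      2 * (n + m + 1) ^ 2 * Real.exp (-(ε ^ 2 / 8) * n) * (n + m).choose n := by
  set w : ℝ := (n / (n + m : ℝ)) ^ n * (1 - n / (n + m : ℝ)) ^ m with hw
  have hC := one_le_choose_mul_pow n m (by omega)
  rw [← hw] at hC
  have hwpos : 0 < w := by
    by_contra h
    have : ((n + m).choose n : ℝ) * w ≤ 0 := mul_nonpos_of_nonneg_of_nonpos (by positivity) (by linarith)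
    have : (n + m + 1 : ℝ) * ((n + m).choose n * w) ≤ 0 :=
      mul_nonpos_of_nonneg_of_nonpos (by positivity) this
    linarith
  set B := fun j : ℕ => (listsOver (Finset.univ : Finset Bool) (n + m)).filter (fun b =>
    b.count true = n ∧ ε * n < |((b.take j).count true : ℝ) - n / (n + m) * j|) with hB
  have hsub : (listsOver (Finset.univ : Finset Bool) (n + m)).filter (fun b => b.count true = n ∧
      ¬ Equidistributed ε b) ⊆ (Finset.range (n + m + 1)).biUnion B := by
    intro b hb
    simp only [Finset.mem_filter, Equidistributed, not_forall, not_le] at hb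
    obtain ⟨hb1, hb2, j, hj, hbj⟩ := hb
    have hl := (mem_listsOver.1 hb1).1
    rw [hb2, hl] at hbj
    simp only [Finset.mem_biUnion, Finset.mem_range, hB, Finset.mem_filter]
    exact ⟨j, by omega, hb1, hb2, by push_cast at hbj; exact hbj⟩
  have hcard := (Finset.card_le_card hsub).trans Finset.card_biUnion_le
  refine le_of_mul_le_mul_right ?_ hwpos
  calc _ ≤ (∑ j ∈ Finset.range (n + m + 1), ((B j).card : ℝ)) * w := by
        gcongr; exact_mod_cast hcard
    _ = ∑ j ∈ Finset.range (n + m + 1), ((B j).card : ℝ) * w := Finset.sum_mul _ _ _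
    _ ≤ ∑ j ∈ Finset.range (n + m + 1), 2 * Real.exp (-(ε ^ 2 / 8) * n) :=
        Finset.sum_le_sum fun j hj => card_filter_deviation_le h0 h1 hm hn j
          (by simpa [Nat.lt_succ_iff] using hj)
    _ = 2 * (n + m + 1) * Real.exp (-(ε ^ 2 / 8) * n) * 1 := by simp; ring
    _ ≤ 2 * (n + m + 1) * Real.exp (-(ε ^ 2 / 8) * n) *
        ((n + m + 1) * ((n + m).choose n * w)) := by gcongr
    _ = _ := by ring

/-! ### Preorder words and the cycle lemma -/

namespace SchroderTree

/-- The preorder sequence of a tree: `0` for a leaf, the number of children minus one for an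
internal vertex. -/
def word : SchroderTree → List ℕ
  | leaf => [0]
  | @node k c => (k + 1) :: (List.finRange (k + 2)).flatMap (fun i => word (c i))

theorem count_word (t : SchroderTree) : t.word.count 0 = t.numLeaves := by
  induction t with
  | leaf => simp [word, numLeaves]
  | node c ih =>
    simp only [word, numLeaves, Fin.sum_univ_def, ← ih]
    simp [List.count_flatMap, Function.comp_def]

theorem length_word (t : SchroderTree) : t.word.length = t.numVertices := by
  induction t with
  | leaf => simp [word, numVertices]
  | node c ih =>
    simp only [word, numVertices, Fin.sum_univ_def, ← ih]
    simp [List.length_flatMap, add_comm]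

theorem sum_word (t : SchroderTree) : t.word.sum + 1 = t.numLeaves := by
  induction t with
  | leaf => simp [word, numLeaves]
  | @node k c ih =>
    simp only [numLeaves, ← ih]
    simp [word, Finset.sum_add_distrib, Fin.sum_univ_def, List.flatMap_def, List.sum_flatten,
      Function.comp_def]
    omega

theorem word_flatMap_append_inj {ι : Type*} (c c' : ι → SchroderTree) (l : List ι)
    (h : ∀ i ∈ l, ∀ t' x y, (c i).word ++ x = word t' ++ y → c i = t' ∧ x = y) (x y : List ℕ)
    (hxy : l.flatMap (fun i => (c i).word) ++ x = l.flatMap (fun i => (c' i).word) ++ y) :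
    (∀ i ∈ l, c i = c' i) ∧ x = y := by
  induction l with
  | nil => simpa using hxy
  | cons i l ih =>
    simp only [List.flatMap_cons, List.append_assoc] at hxy
    obtain ⟨h1, h2⟩ := h i (by simp) _ _ _ hxy
    obtain ⟨h3, h4⟩ := ih (fun j hj => h j (by simp [hj])) h2
    exact ⟨by simpa using ⟨h1, h3⟩, h4⟩

/-- Tree words form a prefix code: the first letter tells how many subtrees remain to be decoded.
The arbitrary tails let the induction pass from one sibling to the next. -/
theorem word_append_inj (t t' : SchroderTree) (x y : List ℕ) (h : t.word ++ x = t'.word ++ y) :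
    t = t' ∧ x = y := by
  induction t generalizing t' x y with
  | leaf =>
    cases t' with
    | leaf => simpa [word] using h
    | node c' => simp [word] at h
  | @node k c ih =>
    cases t' with
    | leaf => simp [word] at h
    | @node k' c' =>
      simp only [word, List.cons_append, List.cons.injEq, add_left_inj] at h
      obtain ⟨rfl, h⟩ := h
      obtain ⟨h1, h2⟩ := word_flatMap_append_inj c c' _ (fun i _ => ih i) x y h
      exact ⟨by rw [funext fun i => h1 i (List.mem_finRange i)], h2⟩

theorem word_injective : Function.Injective word := fun t t' h =>
  (word_append_inj t t' [] [] (by simpa using h)).1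

theorem exists_word_eq_cons (k : ℕ) (l : List SchroderTree) (hl : l.length = k + 2) :
    ∃ t : SchroderTree, t.word = (k + 1) :: l.flatMap word := by
  refine ⟨node (k := k) (fun i => l[(i : ℕ)]'(by omega)), ?_⟩
  rw [word]
  congr 1
  have : l = (List.finRange (k + 2)).map (fun i : Fin (k + 2) => l[(i : ℕ)]'(by omega)) := by
    apply List.ext_getElem <;> simp [hl]
  conv_rhs => rw [this]
  rw [List.flatMap_map]

/-- The number of trees in a forest with preorder sequence `w`. -/
def excess (w : List ℕ) : ℤ := (w.map (fun a : ℕ => if a = 0 then (1 : ℤ) else -(a : ℤ))).sum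

theorem excess_append (v w : List ℕ) : excess (v ++ w) = excess v + excess w := by
  simp [excess]

theorem excess_eq (w : List ℕ) : excess w = w.count 0 - w.sum := by
  induction w with
  | nil => simp [excess]
  | cons a w ih =>
    simp only [excess, List.map_cons, List.sum_cons] at ih ⊢
    rw [ih]
    rcases eq_or_ne a 0 with rfl | h
    · simp; ring
    · simp [h]; ring

/-- Read the word from right to left with a stack of trees: `0` pushes a leaf, and k + 1 replaces
the top k + 2 trees by one tree having them as children. The stack size is the excess of the suffix
read, and its positivity ensures that enough trees are available. -/
theorem exists_forest (w : List ℕ) (h : ∀ v, v ≠ [] → v <:+ w → 1 ≤ excess v) :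
    ∃ F : List SchroderTree, F.flatMap word = w ∧ (F.length : ℤ) = excess w := by
  induction w with
  | nil => exact ⟨[], by simp [excess]⟩
  | cons a w ih =>
    obtain ⟨F, hF, hlen⟩ := ih fun v hv hs => h v hv (hs.trans (List.suffix_cons a w))
    have ha := h (a :: w) (by simp) List.suffix_rfl
    have hcons : excess (a :: w) = excess [a] + excess w := excess_append [a] w
    cases a with
    | zero => exact ⟨leaf :: F, by simp [word, hF], by rw [hcons, ← hlen]; simp [excess]; ring⟩
    | succ k =>
      have e : excess [k + 1] = -(k + 1) := by simp [excess]
      have hk : k + 2 ≤ F.length := by rw [hcons, e] at ha; omega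
      obtain ⟨t, ht⟩ := exists_word_eq_cons k (F.take (k + 2)) (by simp [hk])
      refine ⟨t :: F.drop (k + 2), ?_, ?_⟩
      · rw [List.flatMap_cons, ht, List.cons_append, ← List.flatMap_append, List.take_append_drop,
          hF]
      · rw [hcons, e, ← hlen]; simp [hk]; omega

/-- The cut point of the cycle lemma, built from the right. A new letter joins x if the excess of
the result is positive; otherwise it moves to y together with all of x. -/
theorem exists_split (w : List ℕ) : ∃ x y, w = x ++ y ∧
    (∀ v, v ≠ [] → v <:+ x → 1 ≤ excess v) ∧ ∀ v, v <+: y → excess v ≤ 0 := by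
  induction w with
  | nil => exact ⟨[], [], rfl, by simp +contextual, by simp [excess]⟩
  | cons a w ih =>
    obtain ⟨x, y, rfl, hx, hy⟩ := ih
    rcases le_or_gt 1 (excess (a :: x)) with h | h
    · refine ⟨a :: x, y, by simp, fun v hv hs => ?_, hy⟩
      rcases List.suffix_cons_iff.1 hs with rfl | hs
      · exact h
      · exact hx v hv hs
    · refine ⟨[], a :: (x ++ y), by simp, fun v hv hs => absurd (List.suffix_nil.1 hs) hv,
        fun v hv => ?_⟩
      obtain ⟨u', hv⟩ := hv
      rw [← List.cons_append, List.append_eq_append_iff] at hv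
      -- A prefix ending inside `a :: x` leaves a suffix of x, of positive excess unless empty, so
      -- its own excess is at most that of `a :: x`.
      rcases hv with ⟨u, hu, -⟩ | ⟨v', rfl, hv'⟩
      · replace hu := hu.symm
        have h1 : excess v + excess u = excess (a :: x) := by rw [← excess_append, hu]
        rcases List.eq_nil_or_concat v with rfl | ⟨_, _, rfl⟩
        · simp [excess]
        rcases eq_or_ne u [] with rfl | hu0
        · simp [excess] at h1 h ⊢; omega
        have : u <:+ x := by
          have : u <:+ a :: x := ⟨_, hu⟩
          rcases List.suffix_cons_iff.1 this with rfl | h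
          · have := congrArg List.length hu
            simp at this
            omega
          · exact h
        have := hx u hu0 this
        omega
      · rw [excess_append]; have := hy v' ⟨_, hv'.symm⟩; omega

/-- Every sequence with the right sum is a rotation of the preorder sequence of a tree. -/
theorem exists_rotate_word_eq (w : List ℕ) (hw : excess w = 1) :
    ∃ t : SchroderTree, ∃ r ≤ w.length, t.word.rotate r = w := by
  obtain ⟨x, y, rfl, hx, hy⟩ := exists_split w
  -- A suffix reaching into y has excess 1 minus that of the omitted prefix of y, which is at most
  -- 0.
  obtain ⟨F, hF, hlen⟩ := exists_forest (y ++ x) (by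
    intro v hv hs
    obtain ⟨u, hu⟩ := hs
    rcases List.append_eq_append_iff.1 hu with ⟨v', rfl, rfl⟩ | ⟨b, -, hb⟩
    · have := hy u (List.prefix_append _ _)
      simp only [excess_append] at hw ⊢
      omega
    · exact hx v hv ⟨b, hb.symm⟩)
  rw [excess_append, add_comm, ← excess_append, hw] at hlen
  obtain ⟨t, rfl⟩ : ∃ t, F = [t] := List.length_eq_one_iff.1 (by omega)
  refine ⟨t, y.length, by simp, ?_⟩
  rw [show t.word = y ++ x by simpa using hF, List.rotate_append_length_eq]

end SchroderTree

/-! ### Separating the positions of the zeros from the positive letters -/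

/-- Replace the entries `false` of a list by the entries of a second list, and `true` by `0`. -/
def fillFalse : List Bool → List ℕ → List ℕ
  | [], _ => []
  | true :: b, d => 0 :: fillFalse b d
  | false :: _, [] => []
  | false :: b, a :: d => a :: fillFalse b d

/-- The positions of the zeros of a list. -/
def zeroPattern (w : List ℕ) : List Bool := w.map (fun a => decide (a = 0))

theorem fillFalse_zeroPattern (w : List ℕ) :
    fillFalse (zeroPattern w) (w.filter (fun a => decide (a ≠ 0))) = w := by
  induction w with
  | nil => rfl
  | cons a w ih =>
    rcases eq_or_ne a 0 with rfl | h
    · simpa [zeroPattern, fillFalse] using ih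
    · simpa [zeroPattern, fillFalse, h] using ih

theorem fillFalse_spec (b : List Bool) (d : List ℕ) (hd : ∀ a ∈ d, a ≠ 0)
    (hlen : d.length = b.count false) :
    zeroPattern (fillFalse b d) = b ∧ (fillFalse b d).filter (fun a => decide (a ≠ 0)) = d ∧
      (fillFalse b d).sum = d.sum := by
  induction b generalizing d with
  | nil => simp at hlen; simp [hlen, fillFalse, zeroPattern]
  | cons x b ih =>
    cases x with
    | true =>
      have := ih d hd (by simpa using hlen)
      simpa [fillFalse, zeroPattern] using this
    | false =>
      cases d with
      | nil => simp at hlen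
      | cons a d =>
        have := ih d (fun a h => hd a (by simp [h])) (by simpa using hlen)
        have ha := hd a (by simp)
        simpa [fillFalse, zeroPattern, ha] using this

theorem count_zeroPattern (w : List ℕ) : (zeroPattern w).count true = w.count 0 := by
  induction w with
  | nil => rfl
  | cons a w ih =>
    rcases eq_or_ne a 0 with rfl | h
    · simpa [zeroPattern] using ih
    · simpa [zeroPattern, h] using ih

theorem length_zeroPattern (w : List ℕ) : (zeroPattern w).length = w.length := by
  simp [zeroPattern]

theorem length_eq_count_zero_add (w : List ℕ) :
    w.length = w.count 0 + (w.filter (fun a => decide (a ≠ 0))).length := by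
  induction w with
  | nil => rfl
  | cons a w ih =>
    rcases eq_or_ne a 0 with rfl | h
    · simp [ih]; ring
    · simp [h] at ih ⊢; omega

theorem sum_filter_ne_zero (w : List ℕ) : (w.filter (fun a => decide (a ≠ 0))).sum = w.sum := by
  induction w with
  | nil => rfl
  | cons a w ih =>
    rcases eq_or_ne a 0 with rfl | h
    · simpa using ih
    · simpa [h] using ih

theorem length_le_count_zero_add_sum (w : List ℕ) : w.length ≤ w.count 0 + w.sum := by
  induction w with
  | nil => rfl
  | cons a w ih =>
    rcases eq_or_ne a 0 with rfl | h
    · simp; omega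
    · simp [h]; omega

/-- Sequences with `n` zeros, `m` positive entries and sum `n - 1`. -/
def cyclicWords (n m : ℕ) : Finset (List ℕ) :=
  (listsOver (Finset.range n) (n + m)).filter (fun w => w.count 0 = n ∧ w.sum + 1 = n)

theorem mem_cyclicWords {n m : ℕ} {w : List ℕ} :
    w ∈ cyclicWords n m ↔ w.length = n + m ∧ w.count 0 = n ∧ w.sum + 1 = n := by
  simp only [cyclicWords, Finset.mem_filter, mem_listsOver, Finset.mem_range]
  constructor
  · tauto
  · rintro ⟨h1, h2, h3⟩
    refine ⟨⟨h1, fun a ha => ?_⟩, h2, h3⟩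
    have := List.le_sum_of_mem ha
    omega

/-- Compositions of `n - 1` into `m` parts. -/
def partLists (n m : ℕ) : Finset (List ℕ) :=
  (listsOver (Finset.range n) m).filter (fun d => d.sum + 1 = n ∧ ∀ a ∈ d, a ≠ 0)

theorem mem_partLists {n m : ℕ} {d : List ℕ} :
    d ∈ partLists n m ↔ d.length = m ∧ d.sum + 1 = n ∧ ∀ a ∈ d, a ≠ 0 := by
  simp only [partLists, Finset.mem_filter, mem_listsOver, Finset.mem_range]
  constructor
  · tauto
  · rintro ⟨h1, h2, h3⟩
    refine ⟨⟨h1, fun a ha => ?_⟩, h2, h3⟩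
    have := List.le_sum_of_mem ha
    omega

/-- The lists of `n` entries `true` and `m` entries `false`. -/
def patterns (n m : ℕ) : Finset (List Bool) :=
  (listsOver Finset.univ (n + m)).filter (fun b => b.count true = n)

theorem mem_patterns {n m : ℕ} {b : List Bool} :
    b ∈ patterns n m ↔ b.length = n + m ∧ b.count true = n := by
  simp [patterns, mem_listsOver]

/-- A word is determined by its zero positions and its list of positive letters, and `p` constrains
only the former. `card_patterns_mul_le` is the converse: all pairs occur. -/
theorem card_filter_cyclicWords_le (n m : ℕ) (p : List Bool → Prop) [DecidablePred p] :
    ((cyclicWords n m).filter (fun w => p (zeroPattern w))).card ≤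
      ((patterns n m).filter p).card * (partLists n m).card := by
  rw [← Finset.card_product]
  refine Finset.card_le_card_of_injOn
    (fun w => (zeroPattern w, w.filter (fun a => decide (a ≠ 0)))) ?_ ?_
  · intro w hw
    simp only [Finset.coe_filter, Set.mem_ofPred_eq, mem_cyclicWords] at hw
    have := length_eq_count_zero_add w
    simp only [Finset.coe_product, Set.mem_prod, Finset.mem_coe, Finset.mem_filter, mem_patterns,
      mem_partLists, length_zeroPattern, count_zeroPattern, sum_filter_ne_zero]
    refine ⟨⟨⟨hw.1.1, hw.1.2.1⟩, hw.2⟩, by omega, hw.1.2.2, by simp⟩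
  · intro w _ w' _ h
    simp only [Prod.mk.injEq] at h
    rw [← fillFalse_zeroPattern w, h.1, h.2, fillFalse_zeroPattern]

theorem card_patterns_mul_le (n m : ℕ) :
    (patterns n m).card * (partLists n m).card ≤ (cyclicWords n m).card := by
  rw [← Finset.card_product]
  have spec : ∀ x ∈ patterns n m ×ˢ partLists n m, _ := fun x hx => by
    simp only [Finset.mem_product, mem_patterns, mem_partLists] at hx
    exact fillFalse_spec x.1 x.2 hx.2.2.2 (by
      have := List.count_true_add_count_false x.1
      omega)
  refine Finset.card_le_card_of_injOn (fun x => fillFalse x.1 x.2) ?_ ?_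
  · intro x hx
    obtain ⟨h1, h2, h3⟩ := spec x hx
    simp only [Finset.coe_product, Set.mem_prod, Finset.mem_coe, mem_patterns,
      mem_partLists] at hx
    simp only [Finset.mem_coe, mem_cyclicWords]
    rw [← length_zeroPattern, ← count_zeroPattern, h1, h3]
    exact ⟨hx.1.1, hx.1.2, hx.2.2.1⟩
  · intro x hx y hy h
    obtain ⟨h1, h2, -⟩ := spec x hx
    obtain ⟨h1', h2', -⟩ := spec y hy
    dsimp only at h
    rw [h] at h1 h2
    exact Prod.ext (h1.symm.trans h1') (h2.symm.trans h2')

/-! ### Counting trees with a badly distributed leaf pattern -/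

namespace SchroderTree

theorem numVertices_lt (t : SchroderTree) : t.numVertices < 2 * t.numLeaves := by
  have := length_le_count_zero_add_sum t.word
  have := sum_word t
  rw [count_word, length_word] at *
  omega

theorem numLeaves_le_numVertices (t : SchroderTree) : t.numLeaves ≤ t.numVertices := by
  rw [← count_word, ← length_word]; exact List.count_le_length

theorem word_mem_cyclicWords (t : SchroderTree) :
    t.word ∈ cyclicWords t.numLeaves (t.numVertices - t.numLeaves) := by
  have := numLeaves_le_numVertices t
  exact mem_cyclicWords.2 ⟨by rw [length_word]; omega, count_word t, sum_word t⟩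

theorem finite_setOf_numLeaves_eq (n : ℕ) : {t : SchroderTree | t.numLeaves = n}.Finite := by
  refine Set.Finite.of_finite_image (f := word) ?_ word_injective.injOn
  refine ((Finset.range n).biUnion (cyclicWords n)).finite_toSet.subset ?_
  rintro _ ⟨t, rfl, rfl⟩
  simp only [Finset.mem_coe, Finset.mem_biUnion, Finset.mem_range]
  exact ⟨_, by have := numVertices_lt t; have := numLeaves_le_numVertices t; omega,
    word_mem_cyclicWords t⟩

/-- The finite set of all trees with `n` leaves. -/
noncomputable def treesWithLeaves (n : ℕ) : Finset SchroderTree :=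
  (finite_setOf_numLeaves_eq n).toFinset

theorem mem_treesWithLeaves {n : ℕ} {t : SchroderTree} :
    t ∈ treesWithLeaves n ↔ t.numLeaves = n := by simp [treesWithLeaves]

/-- The cycle lemma in a crude form: at most n+m+1 rotations per tree. -/
theorem card_cyclicWords_le (n m : ℕ) : (cyclicWords n m).card ≤
    (n + m + 1) * ((treesWithLeaves n).filter (fun t => t.numVertices - n = m)).card := by
  classical
  have : cyclicWords n m ⊆ (Finset.range (n + m + 1)).biUnion (fun r =>
      ((treesWithLeaves n).filter (fun t => t.numVertices - n = m)).image
        (fun t => t.word.rotate r)) := by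
    intro w hw
    rw [mem_cyclicWords] at hw
    obtain ⟨t, r, hr, rfl⟩ := exists_rotate_word_eq w (by rw [excess_eq, hw.2.1]; omega)
    rw [(List.rotate_perm _ _).count_eq, List.length_rotate, count_word, length_word] at hw
    rw [List.length_rotate, length_word] at hr
    simp only [Finset.mem_biUnion, Finset.mem_range, Finset.mem_image, Finset.mem_filter,
      mem_treesWithLeaves]
    exact ⟨r, by omega, t, ⟨hw.2.1, by omega⟩, rfl⟩
  refine (Finset.card_le_card this).trans (Finset.card_biUnion_le.trans ?_)
  refine (Finset.sum_le_card_nsmul _ _ _ fun r _ => Finset.card_image_le).trans ?_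
  simp

/-- The positions of the leaves in the preorder sequence. -/
def leafPattern (t : SchroderTree) : List Bool := zeroPattern t.word

-- The trees are sorted by their number m < n of internal vertices. The three factors n + m + 1 ≤ 2n
-- come from the choice of a prefix, the conditioning and the rotation.
open Classical in
theorem card_not_equidistributed_leafPattern_le {ε : ℝ} (h0 : 0 < ε) (h1 : ε ≤ 1) {n : ℕ}
    (hn : 0 < n) :
    (((treesWithLeaves n).filter (fun t => ¬ Equidistributed ε t.leafPattern)).card : ℝ) ≤
      2 * (2 * n) ^ 3 * Real.exp (-(ε ^ 2 / 8) * n) * (treesWithLeaves n).card := by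
  have hmaps : ∀ t ∈ treesWithLeaves n, t.numVertices - n ∈ Finset.range n := by
    intro t ht
    rw [mem_treesWithLeaves] at ht
    have := numVertices_lt t
    simp only [Finset.mem_range]; omega
  rw [Finset.card_eq_sum_card_fiberwise (t := Finset.range n)
      (f := fun t => t.numVertices - n) (fun t ht => hmaps t (Finset.mem_filter.1 ht).1),
    Finset.card_eq_sum_card_fiberwise (t := Finset.range n) hmaps]
  push_cast
  rw [Finset.mul_sum]
  refine Finset.sum_le_sum fun m hm => ?_
  rw [Finset.mem_range] at hm
  set S := (treesWithLeaves n).filter (fun t => t.numVertices - n = m) with hS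
  have s1 : (((treesWithLeaves n).filter (fun t => ¬ Equidistributed ε t.leafPattern)).filter
      (fun t => t.numVertices - n = m)).card ≤
      ((cyclicWords n m).filter (fun w => ¬ Equidistributed ε (zeroPattern w))).card := by
    refine Finset.card_le_card_of_injOn word ?_ word_injective.injOn
    intro t ht
    simp only [Finset.coe_filter, Set.mem_ofPred_eq, Finset.mem_filter, mem_treesWithLeaves] at ht ⊢
    obtain ⟨⟨rfl, h2⟩, rfl⟩ := ht
    exact ⟨word_mem_cyclicWords t, h2⟩
  have s2 := s1.trans (card_filter_cyclicWords_le n m (fun b => ¬ Equidistributed ε b))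
  have s3 : ((patterns n m).card : ℝ) * (partLists n m).card ≤ (n + m + 1) * S.card := by
    exact_mod_cast (card_patterns_mul_le n m).trans (card_cyclicWords_le n m)
  have s4 := card_not_equidistributed_le h0 h1 hm.le hn
  rw [← card_filter_count_listsOver] at s4
  have s5 : (((patterns n m).filter (fun b => ¬ Equidistributed ε b)).card : ℝ) ≤
      2 * (n + m + 1) ^ 2 * Real.exp (-(ε ^ 2 / 8) * n) * (patterns n m).card := by
    rw [patterns, Finset.filter_filter]; exact s4
  have hm2 : (n + m + 1 : ℝ) ≤ 2 * n := by
    have : (m + 1 : ℝ) ≤ n := by exact_mod_cast hm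
    linarith
  calc _ ≤ (((patterns n m).filter (fun b => ¬ Equidistributed ε b)).card : ℝ) *
          (partLists n m).card := by exact_mod_cast s2
    _ ≤ (2 * (n + m + 1) ^ 2 * Real.exp (-(ε ^ 2 / 8) * n) * (patterns n m).card) *
          (partLists n m).card := by gcongr
    _ = 2 * (n + m + 1) ^ 2 * Real.exp (-(ε ^ 2 / 8) * n) * ((patterns n m).card *
          (partLists n m).card) := by ring
    _ ≤ 2 * (n + m + 1) ^ 2 * Real.exp (-(ε ^ 2 / 8) * n) * ((n + m + 1) * S.card) := by gcongr
    _ = 2 * (n + m + 1) ^ 3 * Real.exp (-(ε ^ 2 / 8) * n) * S.card := by ring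
    _ ≤ _ := by gcongr

end SchroderTree

/-! ### Peaks of sequences of up- and down-steps -/

/-- An entry `true` at position `i`, followed by `false`. -/
def IsPeak (e : List Bool) (i : ℕ) : Prop := e[i]? = some true ∧ e[i + 1]? = some false

instance (e : List Bool) : DecidablePred (IsPeak e) := fun _ => instDecidableAnd

/-- The number of peaks among the first `k` positions. -/
def numPeaks (e : List Bool) (k : ℕ) : ℕ := ∑ i ∈ Finset.range k, if IsPeak e i then 1 else 0

/-- For each entry `true`, whether it is followed by `false`. -/
def peakMarks : List Bool → List Bool
  | [] => []
  | true :: e => (e[0]? == some false) :: peakMarks e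
  | false :: e => peakMarks e

theorem numPeaks_cons_succ (s : Bool) (e : List Bool) (k : ℕ) :
    numPeaks (s :: e) (k + 1) = numPeaks e k + if IsPeak (s :: e) 0 then 1 else 0 := by
  rw [numPeaks, Finset.sum_range_succ', numPeaks]
  congr 1

theorem numPeaks_eq (e : List Bool) (k : ℕ) :
    numPeaks e k = ((peakMarks e).take ((e.take k).count true)).count true := by
  induction e generalizing k with
  | nil => simp [numPeaks, IsPeak, peakMarks]
  | cons s e ih =>
    cases k with
    | zero => simp [numPeaks]
    | succ k =>
      rw [numPeaks_cons_succ, ih]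
      cases s
      · simp [IsPeak, peakMarks]
      · simp [IsPeak, peakMarks, List.count_cons]

/-- A mark looks only one entry ahead, so a sequence can be cut right after a `false`. -/
theorem peakMarks_append_false (a b : List Bool) :
    peakMarks (a ++ false :: b) = peakMarks (a ++ [false]) ++ peakMarks b := by
  induction a with
  | nil => simp [peakMarks]
  | cons s a ih =>
    cases s
    · simpa [peakMarks] using ih
    · cases a <;> simp_all [peakMarks]

theorem peakMarks_flatMap_append {ι : Type*} (f : ι → List Bool) (l : List ι) (b : List Bool) :
    peakMarks (l.flatMap (fun i => f i ++ [false]) ++ b) =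
      l.flatMap (fun i => peakMarks (f i ++ [false])) ++ peakMarks b := by
  induction l with
  | nil => simp
  | cons i l ih =>
    rw [List.flatMap_cons, List.flatMap_cons, List.append_assoc, List.append_assoc,
      List.append_assoc, List.singleton_append, peakMarks_append_false, ih]

theorem isPeak_map_not_reverse (e : List Bool) (i : ℕ) (h : i + 1 < e.length) :
    IsPeak (e.reverse.map not) i ↔ IsPeak e (e.length - 2 - i) := by
  simp only [IsPeak, List.getElem?_map]
  rw [List.getElem?_reverse (by omega), List.getElem?_reverse h]
  rw [show e.length - 1 - i = e.length - 2 - i + 1 by omega,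
    show e.length - 1 - (i + 1) = e.length - 2 - i by omega]
  simp [and_comm]

/-- Reversal with exchange of up and down preserves peaks. A peak occupies two positions and the
last position is never one, so only `e.length - 1 - k` positions remain on the mirrored side. -/
theorem numPeaks_add_numPeaks_reverse (e : List Bool) (k : ℕ) (h : k < e.length) :
    numPeaks e k + numPeaks (e.reverse.map not) (e.length - 1 - k) = numPeaks e e.length := by
  have h1 : numPeaks (e.reverse.map not) (e.length - 1 - k) =
      ∑ j ∈ Finset.range (e.length - 1 - k), if IsPeak e (k + j) then 1 else 0 := by
    rw [← Finset.sum_range_reflect, numPeaks]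
    refine Finset.sum_congr rfl fun i hi => ?_
    rw [Finset.mem_range] at hi
    rw [show k + (e.length - 1 - k - 1 - i) = e.length - 2 - i by omega]
    exact if_congr (isPeak_map_not_reverse e i (by omega)) rfl rfl
  have h2 : e.length = k + (e.length - 1 - k) + 1 := by omega
  rw [h1, numPeaks, ← Finset.sum_range_add, numPeaks]
  conv_rhs => rw [h2, Finset.sum_range_succ]
  rw [if_neg, add_zero]
  rintro ⟨-, h3⟩
  rw [← h2] at h3
  simp at h3

/-- The successive partial sums, shifted by `h`, of a sequence of steps `1` and `-1`. -/
def walk : ℤ → List Bool → List ℤ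
  | _, [] => []
  | h, s :: e => (h + if s then 1 else -1) :: walk (h + if s then 1 else -1) e

theorem getD_cons_walk_succ (h : ℤ) (e : List Bool) (i : ℕ) (s : Bool) (hs : e[i]? = some s) :
    (h :: walk h e).getD (i + 1) 0 = (h :: walk h e).getD i 0 + if s then 1 else -1 := by
  induction e generalizing h i with
  | nil => simp at hs
  | cons a e ih =>
    cases i with
    | zero => simp at hs; simp [walk, hs]
    | succ i =>
      have := ih (h + if a then 1 else -1) i (by simpa using hs)
      rw [walk, List.getD_cons_succ, List.getD_cons_succ]
      exact this

/-! ### Depth-first steps, mirror images and the cancellation of the height -/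

namespace SchroderTree

/-- The steps of the depth-first search walk: `true` away from the root, `false` towards it. -/
def steps : SchroderTree → List Bool
  | leaf => []
  | node c => (List.finRange _).flatMap (fun i => (true :: steps (c i)) ++ [false])

/-- The mirror image of a tree. -/
def mirror : SchroderTree → SchroderTree
  | leaf => leaf
  | node c => node (fun i => mirror (c i.rev))

theorem mirror_mirror (t : SchroderTree) : t.mirror.mirror = t := by
  induction t with
  | leaf => rfl
  | node c ih => simp [mirror, ih]

theorem numLeaves_mirror (t : SchroderTree) : t.mirror.numLeaves = t.numLeaves := by
  induction t with
  | leaf => rfl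
  | node c ih =>
    simp only [mirror, numLeaves, ih]
    exact Fintype.sum_equiv Fin.revPerm _ _ fun _ => rfl

theorem numVertices_mirror (t : SchroderTree) : t.mirror.numVertices = t.numVertices := by
  induction t with
  | leaf => rfl
  | node c ih =>
    simp only [mirror, numVertices, ih]
    congr 1
    exact Fintype.sum_equiv Fin.revPerm _ _ fun _ => rfl

theorem steps_mirror (t : SchroderTree) : t.mirror.steps = t.steps.reverse.map not := by
  induction t with
  | leaf => rfl
  | node c ih =>
    simp [mirror, steps, ih, List.reverse_flatMap, List.map_flatMap, List.finRange_reverse,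
      List.flatMap_map, Function.comp_def]

theorem count_true_steps (t : SchroderTree) : t.steps.count true + 1 = t.numVertices := by
  induction t with
  | leaf => rfl
  | node c ih =>
    simp only [numVertices, Fin.sum_univ_def, ← ih, steps, List.count_flatMap]
    simp [Function.comp_def, add_comm]

theorem count_false_steps (t : SchroderTree) : t.steps.count false + 1 = t.numVertices := by
  rw [← numVertices_mirror, ← count_true_steps, steps_mirror]
  congr 1
  rw [← List.count_reverse]
  exact (List.count_map_of_injective _ not Bool.not_injective false).symm

theorem length_steps (t : SchroderTree) : t.steps.length + 2 = 2 * t.numVertices := by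
  have := count_true_steps t
  have := count_false_steps t
  have := List.count_true_add_count_false t.steps
  omega

/-- The up-steps discover the vertices in preorder, and a vertex is a leaf exactly when the next
step goes down. The outer pair of steps stands for the root. -/
theorem leafPattern_eq (t : SchroderTree) :
    t.leafPattern = peakMarks ((true :: t.steps) ++ [false]) := by
  induction t with
  | leaf => simp [leafPattern, word, zeroPattern, steps, peakMarks]
  | @node k c ih =>
    rw [steps, List.cons_append, peakMarks, peakMarks_flatMap_append]
    simp only [leafPattern, word, zeroPattern] at ih ⊢
    simp only [← ih]
    simp [peakMarks, List.map_flatMap, List.finRange_succ]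

theorem leafPattern_node {k : ℕ} (c : Fin (k + 2) → SchroderTree) :
    (node c).leafPattern = false :: peakMarks (node c).steps := by
  have h := peakMarks_flatMap_append (fun i => true :: steps (c i)) (List.finRange (k + 2)) []
  have h' := peakMarks_flatMap_append (fun i => true :: steps (c i)) (List.finRange (k + 2)) [false]
  rw [leafPattern_eq, steps, List.cons_append, peakMarks, h']
  rw [List.append_nil] at h
  rw [h]
  simp [peakMarks, List.finRange_succ]

theorem exists_eq_node {t : SchroderTree} (ht : 2 ≤ t.numLeaves) :
    ∃ k, ∃ c : Fin (k + 2) → SchroderTree, t = node c := by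
  cases t with
  | leaf => simp [numLeaves] at ht
  | node c => exact ⟨_, c, rfl⟩

/-- The `+ 1` accounts for the root, which no up-step discovers. -/
theorem numPeaks_steps {t : SchroderTree} (ht : 2 ≤ t.numLeaves) (k : ℕ) :
    numPeaks t.steps k = (t.leafPattern.take ((t.steps.take k).count true + 1)).count true := by
  obtain ⟨_, c, rfl⟩ := exists_eq_node ht
  rw [numPeaks_eq, leafPattern_node]
  simp

theorem length_leafPattern (t : SchroderTree) : t.leafPattern.length = t.numVertices := by
  rw [leafPattern, length_zeroPattern, length_word]

theorem count_leafPattern (t : SchroderTree) : t.leafPattern.count true = t.numLeaves := by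
  rw [leafPattern, count_zeroPattern, count_word]

theorem numPeaks_steps_of_length_le {t : SchroderTree} (ht : 2 ≤ t.numLeaves) {k : ℕ}
    (hk : t.steps.length ≤ k) : numPeaks t.steps k = t.numLeaves := by
  rw [numPeaks_steps ht, List.take_of_length_le hk, count_true_steps, List.take_of_length_le,
    count_leafPattern]
  rw [length_leafPattern]

theorem abs_numPeaks_sub_le {t : SchroderTree} (ht : 2 ≤ t.numLeaves) {ε : ℝ}
    (h : Equidistributed ε t.leafPattern) (k : ℕ) :
    |(numPeaks t.steps k : ℝ) - t.numLeaves / t.numVertices * ((t.steps.take k).count true + 1)|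
      ≤ ε * t.numLeaves := by
  have h1 := h ((t.steps.take k).count true + 1) (by
    rw [length_leafPattern, ← count_true_steps]
    have := (List.take_sublist k t.steps).count_le true
    omega)
  rw [← numPeaks_steps ht, count_leafPattern, length_leafPattern] at h1
  exact_mod_cast h1

/-- The tree and its mirror image estimate the same proportion of leaves, with opposite errors due
to the height; their average is free of it. -/
theorem abs_numPeaks_div_sub_le {t : SchroderTree} (ht : 2 ≤ t.numLeaves) {ε : ℝ}
    (h : Equidistributed ε t.leafPattern) (h' : Equidistributed ε t.mirror.leafPattern)
    {x : ℝ} (hx : x ∈ Set.Icc (0 : ℝ) 1) :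
    |(numPeaks t.steps ⌊x * t.steps.length⌋₊ : ℝ) / t.numLeaves - x| ≤ ε + 1 / t.numLeaves := by
  set k := ⌊x * t.steps.length⌋₊ with hk
  have hn0 : (0 : ℝ) < t.numLeaves := by exact_mod_cast (show 0 < t.numLeaves by omega)
  have hε : 0 ≤ ε := by
    have := (abs_nonneg _).trans (abs_numPeaks_sub_le ht h 0)
    exact nonneg_of_mul_nonneg_left this hn0
  have hxk : (k : ℝ) ≤ x * t.steps.length :=
    Nat.floor_le (mul_nonneg hx.1 (Nat.cast_nonneg _))
  have hxk' : x * t.steps.length < k + 1 := Nat.lt_floor_add_one _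
  rcases lt_or_ge k t.steps.length with hlt | hge
  · have h1 := abs_numPeaks_sub_le ht h k
    have h2 := abs_numPeaks_sub_le (by rwa [numLeaves_mirror]) h' (t.steps.length - 1 - k)
    have h3 := numPeaks_add_numPeaks_reverse t.steps k hlt
    rw [numPeaks_steps_of_length_le ht le_rfl, ← steps_mirror] at h3
    -- Up-steps of the mirrored walk are down-steps after position k. Step k itself lies on neither
    -- side; δ below records whether it goes up.
    have h4 : ((t.mirror.steps.take (t.steps.length - 1 - k)).count true : ℕ) + 1 + k
        = t.numVertices - 1 + (t.steps.take (k + 1)).count true := by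
      rw [steps_mirror, ← List.map_take, List.take_reverse,
        show true = not false from rfl,
        List.count_map_of_injective _ not Bool.not_injective, List.count_reverse,
        show t.steps.length - (t.steps.length - 1 - k) = k + 1 by omega]
      have a1 := List.count_true_add_count_false (t.steps.drop (k + 1))
      have a2 : (t.steps.take (k + 1)).count true + (t.steps.drop (k + 1)).count true =
          t.steps.count true := by rw [← List.count_append, List.take_append_drop]
      have a3 := count_true_steps t
      have a4 := length_steps t
      rw [List.length_drop] at a1
      simp only [Bool.not_false]
      omega
    have h5 : (t.steps.take (k + 1)).count true = (t.steps.take k).count true ∨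
        (t.steps.take (k + 1)).count true = (t.steps.take k).count true + 1 := by
      rw [List.take_add_one, List.count_append, List.getElem?_eq_getElem hlt]
      cases t.steps[k] <;> simp
    rw [numLeaves_mirror, numVertices_mirror] at h2
    have hnN := numLeaves_le_numVertices t
    have hM := length_steps t
    obtain ⟨δ, hδ, hδ'⟩ : ∃ δ : ℕ, δ ≤ 1 ∧
        (t.steps.take (k + 1)).count true = (t.steps.take k).count true + δ := by
      rcases h5 with h5 | h5
      · exact ⟨0, by omega, h5⟩
      · exact ⟨1, by omega, h5⟩
    rw [hδ'] at h4
    have h4' : ((t.mirror.steps.take (t.steps.length - 1 - k)).count true : ℝ) + 1 + k + 1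
        = t.numVertices + ((t.steps.take k).count true + δ) := by
      norm_cast; omega
    have hM' : (t.steps.length : ℝ) + 2 = 2 * t.numVertices := by exact_mod_cast hM
    have h3' : (numPeaks t.steps k : ℝ) + numPeaks t.mirror.steps (t.steps.length - 1 - k) =
      t.numLeaves := by exact_mod_cast h3
    have hnN' : (t.numLeaves : ℝ) ≤ t.numVertices := by exact_mod_cast hnN
    have hδ1 : (δ : ℝ) ≤ 1 := by exact_mod_cast hδ
    have hδ0 : (0 : ℝ) ≤ δ := Nat.cast_nonneg _
    generalize ((t.mirror.steps.take (t.steps.length - 1 - k)).count true : ℝ) = a at *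
    generalize ((t.steps.take k).count true : ℝ) = b at *
    generalize (numPeaks t.mirror.steps (t.steps.length - 1 - k) : ℝ) = A' at *
    generalize (numPeaks t.steps k : ℝ) = A at *
    generalize (t.numLeaves : ℝ) = n at *
    generalize (t.numVertices : ℝ) = N at *
    generalize (t.steps.length : ℝ) = M at *
    generalize (k : ℝ) = κ at *
    generalize (δ : ℝ) = d at *
    have hN0 : 0 < N := by linarith
    have e1 : |A / n - (b + 1) / N| ≤ ε := by
      rw [show A / n - (b + 1) / N = (A - n / N * (b + 1)) / n by field_simp, abs_div,
        abs_of_pos hn0, div_le_iff₀ hn0]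
      exact h1
    have e2 : |A / n - (κ + 1 - b - d) / N| ≤ ε := by
      rw [show A / n - (κ + 1 - b - d) / N = -((A' - n / N * (a + 1)) / n) by
        rw [show A' = n - A by linarith, show a = N + (b + d) - κ - 2 by linarith]
        field_simp; ring, abs_neg, abs_div, abs_of_pos hn0, div_le_iff₀ hn0]
      exact h2
    -- In the sum of the two estimates b cancels; what remains is the rounding of k and the step d.
    have e3 : |(b + 1) / N + (κ + 1 - b - d) / N - 2 * x| ≤ 2 / n := by
      have : |(b + 1) / N + (κ + 1 - b - d) / N - 2 * x| ≤ 2 / N := by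
        rw [show (b + 1) / N + (κ + 1 - b - d) / N - 2 * x = (κ + 2 - d - 2 * N * x) / N by
          field_simp; ring, abs_div, abs_of_pos hN0]
        gcongr
        rw [← hM', abs_le]
        have := hx.1
        have := hx.2
        constructor <;> linarith
      exact this.trans (by gcongr)
    have e4 : 2 / n = 2 * (1 / n) := by ring
    rw [e4] at e3
    rw [abs_le] at *
    constructor <;> linarith
  · have hM0 : (0 : ℝ) < t.steps.length := by
      have := length_steps t
      have := numLeaves_le_numVertices t
      exact_mod_cast (show 0 < t.steps.length by omega)
    have : (t.steps.length : ℝ) ≤ k := by exact_mod_cast hge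
    have : x = 1 := le_antisymm hx.2 (by
      by_contra hlt
      nlinarith)
    rw [numPeaks_steps_of_length_le ht hge, this, div_self hn0.ne', sub_self, abs_zero]
    positivity

end SchroderTree

/-! ### Local maxima of the contour are the peaks of the walk -/

namespace SchroderTree

theorem measurableSet (s : Set SchroderTree) : MeasurableSet s :=
  MeasurableSpace.measurableSet_top

/-- The starting height and the tail serve the induction: a subtree starts one level higher and is
followed by its right siblings. -/
theorem cons_walk_steps (t : SchroderTree) (h : ℤ) (e : List Bool) :
    h :: walk h (t.steps ++ e) = t.dfs.map (fun p => (p.length : ℤ) + h) ++ walk h e := by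
  induction t generalizing h e with
  | leaf => simp [steps, dfs]
  | @node k c ih =>
    rw [steps, dfs, List.map_cons, List.cons_append]
    congr 1
    · simp
    induction List.finRange (k + 2) with
    | nil => simp
    | cons i l ihl =>
      simp only [List.flatMap_cons, List.cons_append, List.append_assoc, List.map_append, walk,
        List.nil_append, if_true]
      rw [ih, walk, show h + 1 + (if false = true then 1 else -1) = h by simp]
      simp only [List.cons_append] at ihl
      rw [ihl]
      simp only [List.map_map, List.map_cons, Function.comp_def, List.length_cons,
        List.length_nil, List.cons_append]
      congr 2
      · funext p; push_cast; ring
      · simp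

theorem height_eq (t : SchroderTree) (i : ℕ) :
    (t.height i : ℤ) = (0 :: walk 0 t.steps).getD i 0 := by
  have := cons_walk_steps t 0 []
  simp only [List.append_nil, walk, add_zero] at this
  rw [this, height]
  exact (List.getD_map _ [] fun p : List ℕ => (p.length : ℤ)).symm

theorem height_succ (t : SchroderTree) {i : ℕ} {s : Bool} (hs : t.steps[i]? = some s) :
    (t.height (i + 1) : ℝ) = t.height i + if s then 1 else -1 := by
  have : (t.height (i + 1) : ℤ) = t.height i + if s then 1 else -1 := by
    rw [height_eq, height_eq, getD_cons_walk_succ _ _ _ _ hs]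
  cases s <;> exact_mod_cast this

theorem contour_eq (t : SchroderTree) {i : ℕ} {x : ℝ} (h0 : (i : ℝ) ≤ x) (h1 : x ≤ i + 1) :
    t.contour x = t.height i + (x - i) * (t.height (i + 1) - t.height i) := by
  rcases h1.lt_or_eq with h1 | rfl
  · rw [contour, (Nat.floor_eq_iff ((Nat.cast_nonneg i).trans h0)).2 ⟨h0, h1⟩]
  · rw [contour, show (i : ℝ) + 1 = ((i + 1 : ℕ) : ℝ) by push_cast; rfl, Nat.floor_natCast]
    push_cast
    ring

theorem mem_leafCoordinates_iff_exists {t : SchroderTree} (ht : 2 ≤ t.numLeaves) (u : ℝ) :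
    u ∈ t.leafCoordinates ↔ u ∈ Set.Icc (0 : ℝ) 1 ∧ ∃ δ > 0,
      ∀ y ∈ Set.Icc (0 : ℝ) t.steps.length, |y - u * t.steps.length| < δ →
        t.contour y ≤ t.contour (u * t.steps.length) := by
  have hn := numLeaves_le_numVertices t
  have hM := length_steps t
  have hM0 : (0 : ℝ) < t.steps.length := by exact_mod_cast (show 0 < t.steps.length by omega)
  have hM1 : (2 * (t.numVertices : ℝ) - 2) = t.steps.length := by
    have : (t.steps.length : ℝ) + 2 = 2 * t.numVertices := by exact_mod_cast hM
    linarith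
  have hc : 0 < 1 / Real.sqrt (t.numLeaves : ℝ) := by
    have : (0 : ℝ) < t.numLeaves := by exact_mod_cast (show 0 < t.numLeaves by omega)
    positivity
  have hle : ∀ v w : ℝ, t.normalizedContour v ≤ t.normalizedContour w ↔
      t.contour (v * t.steps.length) ≤ t.contour (w * t.steps.length) := by
    intro v w
    rw [normalizedContour, normalizedContour, hM1, mul_le_mul_iff_right₀ hc, mul_comm v, mul_comm w]
  rw [leafCoordinates, Set.mem_ofPred_eq]
  refine and_congr_right fun hu => ?_
  rw [IsLocalMaxOn, IsMaxFilter, Metric.nhdsWithin_basis_ball.eventually_iff]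
  generalize (t.steps.length : ℝ) = M at *
  constructor
  · rintro ⟨δ, hδ, h⟩
    refine ⟨δ * M, by positivity, fun y hy hyu => ?_⟩
    have := @h (y / M) ⟨?_, ⟨div_nonneg hy.1 hM0.le, (div_le_one hM0).2 hy.2⟩⟩
    · rwa [hle, div_mul_cancel₀ _ hM0.ne'] at this
    · rw [Metric.mem_ball, Real.dist_eq, show y / M - u = (y - u * M) / M by field_simp, abs_div,
        abs_of_pos hM0, div_lt_iff₀ hM0]
      exact hyu
  · rintro ⟨δ, hδ, h⟩
    refine ⟨δ / M, by positivity, fun v ⟨hv, hv1⟩ => ?_⟩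
    rw [hle]
    refine h _ ⟨mul_nonneg hv1.1 hM0.le, by nlinarith [hv1.2]⟩ ?_
    rw [Metric.mem_ball, Real.dist_eq, lt_div_iff₀ hM0] at hv
    rwa [← sub_mul, abs_mul, abs_of_pos hM0]

theorem height_succ_le {t : SchroderTree} {i : ℕ} {x δ : ℝ} (hi : i < t.steps.length)
    (hδ : 0 < δ) (h : ∀ y ∈ Set.Icc (0 : ℝ) t.steps.length, |y - x| < δ → t.contour y ≤ t.contour x)
    (h0 : (i : ℝ) ≤ x) (h1 : x < i + 1) : (t.height (i + 1) : ℝ) ≤ t.height i := by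
  have hi' : (i : ℝ) + 1 ≤ t.steps.length := by exact_mod_cast hi
  have hi0 : (0 : ℝ) ≤ i := Nat.cast_nonneg i
  obtain ⟨y, hxy, hy1, hyδ⟩ : ∃ y, x < y ∧ y ≤ i + 1 ∧ y < x + δ :=
    ⟨min (i + 1) (x + δ / 2), by rw [lt_min_iff]; constructor <;> linarith, min_le_left _ _,
      (min_le_right _ _).trans_lt (by linarith)⟩
  have := h y ⟨by linarith, by linarith⟩ (by rw [abs_lt]; constructor <;> linarith)
  rw [contour_eq t (h0.trans hxy.le) hy1, contour_eq t h0 h1.le] at this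
  by_contra! hlt
  nlinarith [mul_pos (sub_pos.2 hlt) (sub_pos.2 hxy)]

theorem height_le_succ {t : SchroderTree} {i : ℕ} {x δ : ℝ} (hi : i < t.steps.length)
    (hδ : 0 < δ) (h : ∀ y ∈ Set.Icc (0 : ℝ) t.steps.length, |y - x| < δ → t.contour y ≤ t.contour x)
    (h0 : (i : ℝ) < x) (h1 : x ≤ i + 1) : (t.height i : ℝ) ≤ t.height (i + 1) := by
  have hi' : (i : ℝ) + 1 ≤ t.steps.length := by exact_mod_cast hi
  have hi0 : (0 : ℝ) ≤ i := Nat.cast_nonneg i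
  obtain ⟨y, hxy, hy1, hyδ⟩ : ∃ y, y < x ∧ i ≤ y ∧ x - δ < y :=
    ⟨max i (x - δ / 2), by rw [max_lt_iff]; constructor <;> linarith, le_max_left _ _,
      lt_of_lt_of_le (by linarith) (le_max_right _ _)⟩
  have := h y ⟨by linarith, by linarith⟩ (by rw [abs_lt]; constructor <;> linarith)
  rw [contour_eq t hy1 (hxy.le.trans h1), contour_eq t h0.le h1] at this
  by_contra! hlt
  nlinarith [mul_pos (sub_pos.2 hlt) (sub_pos.2 hxy)]

/-- Every edge of the contour has slope ±1, so a local maximum lies at an integer time, with no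
descent before it and no ascent after it. The first step goes up and the last one down, which
excludes both endpoints. -/
theorem mem_leafCoordinates {t : SchroderTree} (ht : 2 ≤ t.numLeaves) (u : ℝ) :
    u ∈ t.leafCoordinates ↔
      ∃ i, IsPeak t.steps i ∧ ((i : ℝ) + 1) / t.steps.length = u := by
  have hM0' : 0 < t.steps.length := by
    have := numLeaves_le_numVertices t
    have := length_steps t
    omega
  have hM0 : (0 : ℝ) < t.steps.length := by exact_mod_cast hM0'
  have up : ∀ {i}, t.steps[i]? = some true → (t.height (i + 1) : ℝ) = t.height i + 1 :=
    fun hs => by simpa using height_succ t hs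
  have down : ∀ {i}, t.steps[i]? = some false → (t.height (i + 1) : ℝ) = t.height i - 1 :=
    fun hs => by simpa [sub_eq_add_neg] using height_succ t hs
  rw [mem_leafCoordinates_iff_exists ht]
  constructor
  · rintro ⟨hu, δ, hδ, h⟩
    have hx0 : 0 ≤ u * t.steps.length := mul_nonneg hu.1 hM0.le
    have hx1 : u * t.steps.length ≤ t.steps.length := by nlinarith [hu.2]
    have hux : u * t.steps.length / t.steps.length = u := mul_div_cancel_right₀ _ hM0.ne'
    generalize u * t.steps.length = x at *
    have right : ∀ i : ℕ, (i : ℝ) ≤ x → x < i + 1 → i < t.steps.length →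
        t.steps[i]? = some false := by
      intro i h0 h1 hi
      have h2 := height_succ_le hi hδ h h0 h1
      rw [List.getElem?_eq_getElem hi]
      have := up (i := i)
      rw [List.getElem?_eq_getElem hi] at this
      cases hs : t.steps[i] with
      | false => rfl
      | true => linarith [this (by rw [hs])]
    have left : ∀ i : ℕ, (i : ℝ) < x → x ≤ i + 1 → i < t.steps.length →
        t.steps[i]? = some true := by
      intro i h0 h1 hi
      have h2 := height_le_succ hi hδ h h0 h1
      rw [List.getElem?_eq_getElem hi]
      have := down (i := i)
      rw [List.getElem?_eq_getElem hi] at this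
      cases hs : t.steps[i] with
      | true => rfl
      | false => linarith [this (by rw [hs])]
    have hstart : t.steps[0]? = some true := by
      obtain ⟨_, c, rfl⟩ := exists_eq_node ht
      simp [steps, List.finRange_succ]
    have hend : t.steps[t.steps.length - 1]? = some false := by
      obtain ⟨k, c, rfl⟩ := exists_eq_node ht
      rw [← List.getLast?_eq_getElem?, steps, List.finRange_succ_last, List.flatMap_append,
        List.flatMap_singleton, ← List.append_assoc, List.getLast?_concat]
    obtain ⟨i, hi0, hi1⟩ : ∃ i : ℕ, (i : ℝ) < x ∧ x ≤ i + 1 := by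
      have hxpos : 0 < x := by
        refine hx0.lt_of_ne fun hx => ?_
        have := right 0 (by simp [← hx]) (by simp [← hx]) hM0'
        rw [hstart] at this
        simp at this
      have hc : 0 < ⌈x⌉₊ := Nat.ceil_pos.2 hxpos
      obtain ⟨i, hi⟩ := Nat.exists_eq_succ_of_ne_zero hc.ne'
      refine ⟨i, Nat.lt_ceil.1 (by omega), ?_⟩
      have := Nat.le_ceil x
      rw [hi] at this
      simpa using this
    have hiM : i < t.steps.length := by exact_mod_cast hi0.trans_le hx1
    have h1 := left i hi0 hi1 hiM
    have hx : x = i + 1 := by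
      by_contra hne
      have := right i hi0.le (hi1.lt_of_ne hne) hiM
      rw [h1] at this
      simp at this
    have hiM' : i + 1 < t.steps.length := by
      by_contra hge
      rw [show t.steps.length - 1 = i by omega, h1] at hend
      simp at hend
    refine ⟨i, ⟨h1, right (i + 1) (by push_cast; linarith) (by push_cast; linarith) hiM'⟩, ?_⟩
    rw [← hx, hux]
  · rintro ⟨i, ⟨hi1, hi2⟩, rfl⟩
    have hiM : i + 1 < t.steps.length := (List.getElem?_eq_some_iff.1 hi2).1
    have hiM' : (i : ℝ) + 1 < t.steps.length := by exact_mod_cast hiM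
    have hi0 : (0 : ℝ) ≤ i := Nat.cast_nonneg i
    -- Radius 1 stays on the two edges meeting at time i + 1.
    refine ⟨⟨by positivity, (div_le_one hM0).2 hiM'.le⟩, 1, one_pos, fun y _ hy => ?_⟩
    rw [div_mul_cancel₀ _ hM0.ne'] at hy ⊢
    rw [abs_lt] at hy
    rw [contour_eq t (i := i) (x := i + 1) (by linarith) le_rfl]
    have e1 := up hi1
    have e2 := down hi2
    rcases le_total y (i + 1) with h | h
    · rw [contour_eq t (i := i) (by linarith) h, e1]
      nlinarith
    · rw [contour_eq t (i := i + 1) (by push_cast; linarith) (by push_cast; linarith), e2, e1]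
      push_cast
      nlinarith

theorem leafDistribution_of_nonneg {t : SchroderTree} (ht : 2 ≤ t.numLeaves) {x : ℝ}
    (hx : 0 ≤ x) :
    t.leafDistribution x = numPeaks t.steps ⌊x * t.steps.length⌋₊ / t.numLeaves := by
  have hM0 : (0 : ℝ) < t.steps.length := by
    have := numLeaves_le_numVertices t
    have := length_steps t
    exact_mod_cast (show 0 < t.steps.length by omega)
  have : {l ∈ t.leafCoordinates | l ≤ x} = (fun i : ℕ => ((i : ℝ) + 1) / t.steps.length) ''
      ((Finset.range ⌊x * t.steps.length⌋₊).filter (IsPeak t.steps) : Finset ℕ) := by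
    ext u
    simp only [Set.mem_ofPred_eq, mem_leafCoordinates ht, Set.mem_image, Finset.coe_filter,
      Finset.mem_range]
    constructor
    · rintro ⟨⟨i, hi, rfl⟩, hux⟩
      refine ⟨i, ⟨?_, hi⟩, rfl⟩
      rw [div_le_iff₀ hM0] at hux
      exact Nat.le_floor (by push_cast; exact hux)
    · rintro ⟨i, ⟨hi, hp⟩, rfl⟩
      refine ⟨⟨i, hp, rfl⟩, ?_⟩
      rw [div_le_iff₀ hM0]
      have := (Nat.le_floor_iff (mul_nonneg hx hM0.le)).1 (Nat.succ_le_of_lt hi)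
      push_cast at this
      exact this
  rw [leafDistribution, this, Set.ncard_image_of_injective, Set.ncard_coe_finset,
    Finset.card_filter, numPeaks]
  · ring
  · intro i j hij
    have := (div_left_inj' hM0.ne').1 hij
    exact_mod_cast add_right_cancel this

theorem leafDistribution_of_neg {t : SchroderTree} {x : ℝ} (hx : x < 0) :
    t.leafDistribution x = 0 := by
  have : {l ∈ t.leafCoordinates | l ≤ x} = ∅ := by
    ext u
    simp only [Set.mem_ofPred_eq, Set.mem_empty_iff_false, iff_false, not_and, not_le]
    exact fun hu => hx.trans_le hu.1.1
  rw [leafDistribution, this]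
  simp

theorem abs_leafDistribution_sub_le {t : SchroderTree} (ht : 2 ≤ t.numLeaves) {ε : ℝ}
    (h : Equidistributed ε t.leafPattern) (h' : Equidistributed ε t.mirror.leafPattern) (x : ℝ) :
    |t.leafDistribution x - uniformDistribution x| ≤ ε + 1 / t.numLeaves := by
  have key := fun {y : ℝ} hy => abs_numPeaks_div_sub_le (x := y) ht h h' hy
  have hnonneg := (abs_nonneg _).trans (key (y := 0) (by simp))
  rcases lt_or_ge x 0 with h0 | h0
  · rwa [leafDistribution_of_neg h0, uniformDistribution, if_pos h0, sub_zero, abs_zero]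
  rw [leafDistribution_of_nonneg ht h0, uniformDistribution, if_neg h0.not_gt]
  split_ifs with h1
  · exact key ⟨h0, h1⟩
  · rw [numPeaks_steps_of_length_le ht, div_self, sub_self, abs_zero]
    · exact hnonneg
    · exact_mod_cast (show t.numLeaves ≠ 0 by omega)
    · refine Nat.le_floor ?_
      have : (0 : ℝ) ≤ t.steps.length := Nat.cast_nonneg _
      nlinarith

/-! ### Exceptional probabilities and Borel–Cantelli -/

-- Mirroring is an involution preserving the number of leaves, so the mirrored condition fails no
-- more often; the union bound doubles 2(2n)³.
open Classical in
theorem card_not_equidistributed_mirror_le {ε : ℝ} (h0 : 0 < ε) (h1 : ε ≤ 1) {n : ℕ}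
    (hn : 0 < n) :
    (((treesWithLeaves n).filter (fun t => ¬ (Equidistributed ε t.leafPattern ∧
      Equidistributed ε t.mirror.leafPattern))).card : ℝ) ≤
      32 * n ^ 3 * Real.exp (-(ε ^ 2 / 8) * n) * (treesWithLeaves n).card := by
  have hA := card_not_equidistributed_leafPattern_le h0 h1 hn
  set A := (treesWithLeaves n).filter (fun t => ¬ Equidistributed ε t.leafPattern)
  have hB : ((treesWithLeaves n).filter
      (fun t => ¬ Equidistributed ε t.mirror.leafPattern)).card ≤ A.card := by
    refine Finset.card_le_card_of_injOn mirror (fun t ht => ?_)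
      (Function.LeftInverse.injective mirror_mirror).injOn
    simpa [A, mem_treesWithLeaves, numLeaves_mirror] using ht
  have hAB : ((treesWithLeaves n).filter (fun t => ¬ (Equidistributed ε t.leafPattern ∧
      Equidistributed ε t.mirror.leafPattern))).card ≤ A.card + A.card := by
    refine le_trans ?_ (Nat.add_le_add_left hB _)
    refine le_trans (Finset.card_le_card fun t ht => ?_) (Finset.card_union_le _ _)
    simp only [A, Finset.mem_union, Finset.mem_filter] at ht ⊢
    tauto
  have hAB' : (((treesWithLeaves n).filter (fun t => ¬ (Equidistributed ε t.leafPattern ∧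
      Equidistributed ε t.mirror.leafPattern))).card : ℝ) ≤ A.card + A.card := by
    exact_mod_cast hAB
  nlinarith

theorem uniformOn_not_equidistributed_le {ε : ℝ} (h0 : 0 < ε) (h1 : ε ≤ 1) {n : ℕ} (hn : 0 < n) :
    uniformOn {t : SchroderTree | t.numLeaves = n} {t | ¬ (Equidistributed ε t.leafPattern ∧
      Equidistributed ε t.mirror.leafPattern)} ≤
      ENNReal.ofReal (32 * n ^ 3 * Real.exp (-(ε ^ 2 / 8) * n)) := by
  classical
  have hS : {t : SchroderTree | t.numLeaves = n} = (treesWithLeaves n : Set SchroderTree) := by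
    ext t; simp [mem_treesWithLeaves]
  have hI : (treesWithLeaves n : Set SchroderTree) ∩ {t | ¬ (Equidistributed ε t.leafPattern ∧
      Equidistributed ε t.mirror.leafPattern)} = ((treesWithLeaves n).filter (fun t =>
      ¬ (Equidistributed ε t.leafPattern ∧ Equidistributed ε t.mirror.leafPattern)) :
        Finset SchroderTree) := by
    ext t; simp
  have hc := card_not_equidistributed_mirror_le h0 h1 hn
  rw [hS, uniformOn, cond_apply (measurableSet _), hI, Measure.count_apply_finset' (measurableSet _),
    Measure.count_apply_finset' (measurableSet _), mul_comm, ← div_eq_mul_inv]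
  refine ENNReal.div_le_of_le_mul ?_
  rw [← ENNReal.ofReal_natCast, ← ENNReal.ofReal_natCast, ← ENNReal.ofReal_mul (by positivity)]
  exact ENNReal.ofReal_le_ofReal hc

end SchroderTree

open SchroderTree in
theorem ae_eventually_equidistributed {Ω : Type*} [MeasurableSpace Ω] (P : Measure Ω)
    (T : ℕ → Ω → SchroderTree)
    (hT : ∀ n : ℕ, 2 ≤ n → HasLaw (T n) (uniformOn {t : SchroderTree | t.numLeaves = n}) P)
    {ε : ℝ} (h0 : 0 < ε) (h1 : ε ≤ 1) :
    ∀ᵐ ω ∂P, ∀ᶠ n in atTop, Equidistributed ε (T n ω).leafPattern ∧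
      Equidistributed ε (T n ω).mirror.leafPattern := by
  set B : Set SchroderTree := {t | ¬ (Equidistributed ε t.leafPattern ∧
      Equidistributed ε t.mirror.leafPattern)} with hB
  have hs : Summable (fun n : ℕ => 32 * (n : ℝ) ^ 3 * Real.exp (-(ε ^ 2 / 8) * n)) := by
    have := (Real.summable_pow_mul_exp_neg_nat_mul 3 (r := ε ^ 2 / 8) (by positivity)).mul_left 32
    simpa [mul_assoc] using this
  -- The shift by 2 avoids T 0 and T 1, whose laws are not prescribed.
  have hsum : ∑' n, P (T (n + 2) ⁻¹' B) ≠ ⊤ := by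
    refine ne_top_of_le_ne_top ((summable_nat_add_iff 2).2 hs).tsum_ofReal_ne_top
      (ENNReal.tsum_le_tsum fun n => ?_)
    have hlaw := hT (n + 2) (by omega)
    rw [← Measure.map_apply_of_aemeasurable hlaw.aemeasurable (measurableSet _), hlaw.map_eq]
    exact uniformOn_not_equidistributed_le h0 h1 (by omega)
  filter_upwards [ae_eventually_notMem hsum] with ω hω
  obtain ⟨n₀, hn₀⟩ := eventually_atTop.1 hω
  filter_upwards [eventually_ge_atTop (n₀ + 2)] with n hn
  have := hn₀ (n - 2) (by omega)
  rw [Nat.sub_add_cancel (by omega)] at this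
  simpa [hB] using this

theorem ae_forall_numLeaves_eq {Ω : Type*} [MeasurableSpace Ω] (P : Measure Ω)
    (T : ℕ → Ω → SchroderTree)
    (hT : ∀ n : ℕ, 2 ≤ n → HasLaw (T n) (uniformOn {t : SchroderTree | t.numLeaves = n}) P) :
    ∀ᵐ ω ∂P, ∀ n, 2 ≤ n → (T n ω).numLeaves = n := by
  rw [ae_all_iff]
  intro n
  by_cases hn : 2 ≤ n
  · have : ∀ᵐ t ∂(uniformOn {t : SchroderTree | t.numLeaves = n}), t.numLeaves = n :=
      ae_cond_mem (SchroderTree.measurableSet _)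
    rw [← (hT n hn).map_eq] at this
    filter_upwards [ae_of_ae_map (hT n hn).aemeasurable this] with ω hω _ using hω
  · exact Eventually.of_forall fun ω h => absurd h hn

theorem mainTheorem8 {Ω : Type*} [MeasurableSpace Ω] (P : Measure Ω) [IsProbabilityMeasure P]
    (T : ℕ → Ω → SchroderTree)
    (hT : ∀ n : ℕ, 2 ≤ n → HasLaw (T n) (uniformOn {t : SchroderTree | t.numLeaves = n}) P) :
    ∀ᵐ ω ∂P, Tendsto
      (fun n : ℕ => ⨆ x : ℝ, ‖(T n ω).leafDistribution x - uniformDistribution x‖ₑ)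
      atTop (𝓝 0) := by
  -- Countably many tolerances suffice, so a single null set serves them all.
  have hae : ∀ᵐ ω ∂P, ∀ r : ℕ, ∀ᶠ n in atTop,
      Equidistributed (1 / ((r : ℝ) + 1)) (T n ω).leafPattern ∧
        Equidistributed (1 / ((r : ℝ) + 1)) (T n ω).mirror.leafPattern :=
    ae_all_iff.2 fun r => ae_eventually_equidistributed P T hT (by positivity)
      ((div_le_one (by positivity)).2 (by simp))
  filter_upwards [hae, ae_forall_numLeaves_eq P T hT] with ω hω hleaves
  rw [ENNReal.tendsto_nhds_zero]
  intro η hη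
  obtain ⟨ρ, hρ0, hρη⟩ : ∃ ρ : ℝ, 0 < ρ ∧ ENNReal.ofReal ρ ≤ η := by
    obtain ⟨ρ, hρ0, hρ⟩ := ENNReal.lt_iff_exists_nnreal_btwn.1 hη
    exact ⟨ρ, by exact_mod_cast hρ0, by simpa using hρ.le⟩
  obtain ⟨r, hr⟩ := exists_nat_one_div_lt (half_pos hρ0)
  filter_upwards [hω r, eventually_ge_atTop 2,
    (tendsto_one_div_atTop_nhds_zero_nat (𝕜 := ℝ)).eventually_lt_const (half_pos hρ0)]
    with n hn hn2 hnρ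
  refine iSup_le fun x => le_trans ?_ hρη
  rw [Real.enorm_eq_ofReal_abs]
  refine ENNReal.ofReal_le_ofReal ?_
  have := SchroderTree.abs_leafDistribution_sub_le (by rw [hleaves n hn2]; exact hn2) hn.1 hn.2 x
  rw [hleaves n hn2] at this
  linarith
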